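/- Let $k$ be a field and $n\ge 2$. The commuting graph $\Gamma$ of $\mathrm{Mat}_{n\times n}(k)$ has as vertices the non-scalar $n\times n$ matrices over $k$ (those that are not constant multiples of the identity), with an edge between two distinct vertices $A,B$ if and only if $AB=BA$. For non-scalar $A,B$ let $d(A,B)\in\mathbb{N}\cup\{\infty\}$ be their distance in $\Gamma$, with $d(A,B)=\infty$ if they lie in different connected components; if $A$ or $B$ is scalar, put $d(A,B)=1$ if $A\ne B$ and $d(A,B)=0$ if $A=B$. For an integer $d\ge 0$ let $$\mathcal{C}^d_n(k)=\{(A,B)\in \mathrm{Mat}_{n\times n}(k)^2 : d(A,B)\le d\}.$$ Identify $\mathrm{Mat}_{n\times n}(k)^2$ with the $2n^2$-dimensional affine space $k^{2n^2}$ through the matrix entries; a subset of $k^{2n^2}$ is an affine variety if it is the set of common zeros in $k^{2n^2}$ of finitely many polynomials with coefficients in $k$ (it need not be irreducible). (1) If $k$ is algebraically closed, then $\mathcal{C}^d_n(k)$ is an affine variety for every integer $d\ge 0$. (2) For an arbitrary field $k$, $\mathcal{C}^d_n(k)$ is an affine variety for every $d\in\{0,1,2\}$. -/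

import Mathlib

/-- A square matrix is scalar if it is a constant multiple of the identity matrix. -/
def IsScalarMatrix {k : Type*} [Field k] {n : ℕ} (A : Matrix (Fin n) (Fin n) k) : Prop :=
  ∃ c : k, A = c • (1 : Matrix (Fin n) (Fin n) k)

/-- The commuting graph of `n × n` matrices over `k`: its vertices are the non-scalar matrices,
and two distinct vertices are adjacent exactly when they commute. -/
def commutingGraph (k : Type*) [Field k] (n : ℕ) :
    SimpleGraph {A : Matrix (Fin n) (Fin n) k // ¬ IsScalarMatrix A} where
  Adj A B := A ≠ B ∧ A.1 * B.1 = B.1 * A.1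
  symm := ⟨fun _ _ h => ⟨h.1.symm, h.2.symm⟩⟩
  loopless := ⟨fun _ h => h.1 rfl⟩

open Classical in
/-- The commuting distance of two matrices: for non-scalar matrices, the length of a shortest path
in the commuting graph (`⊤` if there is no path); if one of the matrices is scalar, it is `0` or `1`
according to whether the two matrices are equal or not. -/
noncomputable def commutingDist {k : Type*} [Field k] {n : ℕ}
    (A B : Matrix (Fin n) (Fin n) k) : ℕ∞ :=
  if h : ¬ IsScalarMatrix A ∧ ¬ IsScalarMatrix B then
    (commutingGraph k n).edist ⟨A, h.1⟩ ⟨B, h.2⟩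
  else if A = B then 0 else 1

/-- The distance-`d` commuting set: all pairs of matrices at commuting distance at most `d`. -/
def commutingSet (k : Type*) [Field k] (n d : ℕ) :
    Set (Matrix (Fin n) (Fin n) k × Matrix (Fin n) (Fin n) k) :=
  {p | commutingDist p.1 p.2 ≤ (d : ℕ∞)}

/-- A subset of the affine space `k^σ` is an affine variety if it is the set of common zeros of
finitely many polynomials with coefficients in `k`. -/
def IsAffineVariety {k : Type*} [Field k] {σ : Type*} (V : Set (σ → k)) : Prop :=
  ∃ S : Finset (MvPolynomial σ k), V = {a | ∀ f ∈ S, MvPolynomial.eval a f = 0}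

/-- The identification of pairs of `n × n` matrices with points of the `2n²`-dimensional affine
space: the left coordinates are the entries of the first matrix, the right ones those of the
second. -/
def matrixPairEquiv (k : Type*) (n : ℕ) :
    Matrix (Fin n) (Fin n) k × Matrix (Fin n) (Fin n) k ≃
      ((Fin n × Fin n) ⊕ (Fin n × Fin n) → k) where
  toFun p := Sum.elim (fun ij => p.1 ij.1 ij.2) (fun ij => p.2 ij.1 ij.2)
  invFun a := (Matrix.of fun i j => a (Sum.inl (i, j)), Matrix.of fun i j => a (Sum.inr (i, j)))
  left_inv _ := rfl
  right_inv a := by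
    ext (ij | ij) <;> rfl

/-!
# The distance-`d` commuting set is an affine variety

For `n ≥ 2`, two matrices `A`, `B` satisfy `d(A, B) ≤ d + 1` exactly when there is a chain
`A, C₁, …, C_d, B` of consecutively commuting matrices in which the `Cᵢ` are non-scalar; this also
holds for scalar `A` or `B` (`mem_commutingSet_succ`). The conditions on `Cᵢ` only depend on its
class modulo scalar matrices and are unchanged under rescaling, so the `Cᵢ` range over a projective
space, and projections along projective spaces are closed.

By Hilbert's basis theorem, closedness of a set means that every point `a` outside it is separated
from it by one polynomial (`isAffineVariety_of_separated`). The elimination step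
(`exists_separating_projection`) produces this polynomial as follows. Let `V` be a closed set of
pairs `(a, w)` that is a cone in `w`, and suppose that the fibre over `a` contains no nonzero `w`.
By the Nullstellensatz, for some `D` each monomial of degree `D` in `w` is the value at `a` of an
equation of `V`, which may be taken homogeneous of degree `D` in `w`. The coefficients of these
equations form a square matrix of polynomials whose value at `a` is the identity; at any point `b`
whose fibre contains some `w ≠ 0` it kills the nonzero vector of monomials in `w`. Its determinant
is the required polynomial. Applied to the `Cᵢ` one after the other, this treats all `d` over an
algebraically closed field (`exists_separating_commutingChainSet`).

Over an arbitrary field, distances `0` and `1` are the explicit conditions `A = B` and `A B = B A`,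
and for distance `2` the single matrix `C₁` is a solution of a system of homogeneous linear
equations, for which linear algebra replaces the Nullstellensatz
(`exists_separating_linear_system`).
-/

/-! ### Separation by polynomials -/

/-- Hilbert's basis theorem: a set is a variety as soon as each point outside it is separated from
it by a polynomial. -/
theorem isAffineVariety_of_separated {k : Type*} [Field k] {σ : Type*} [Finite σ] {V : Set (σ → k)}
    (h : ∀ a ∉ V, ∃ f : MvPolynomial σ k,
      (∀ b ∈ V, MvPolynomial.eval b f = 0) ∧ MvPolynomial.eval a f ≠ 0) :
    IsAffineVariety V := by
  obtain ⟨S, hS⟩ := IsNoetherian.noetherian (MvPolynomial.vanishingIdeal k V)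
  refine ⟨S, Set.Subset.antisymm ?_ ?_⟩
  · intro b hb f hf
    have : f ∈ MvPolynomial.vanishingIdeal k V := hS ▸ Ideal.subset_span hf
    simpa [MvPolynomial.aeval_eq_eval] using MvPolynomial.mem_vanishingIdeal_iff.1 this b hb
  · intro a ha
    by_contra haV
    obtain ⟨f, hf, hfa⟩ := h a haV
    have hfI : f ∈ Ideal.span (S : Set (MvPolynomial σ k)) := by
      change f ∈ Submodule.span _ _
      rw [hS, MvPolynomial.mem_vanishingIdeal_iff]
      simpa [MvPolynomial.aeval_eq_eval] using hf
    have hle : Ideal.span (S : Set (MvPolynomial σ k)) ≤ RingHom.ker (MvPolynomial.eval a) :=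
      Ideal.span_le.2 fun g hg => ha g hg
    exact hfa (hle hfI)

/-! ### Elimination of a projective variable -/

theorem MvPolynomial.eval_smul_homogeneousComponent {k : Type*} [CommRing k] {τ : Type*}
    (q : MvPolynomial τ k) (w : τ → k) (c : k) (i : ℕ) :
    eval (c • w) (homogeneousComponent i q) = c ^ i * eval w (homogeneousComponent i q) := by
  rw [eval_eq, eval_eq, Finset.mul_sum]
  refine Finset.sum_congr rfl fun m hm => ?_
  have hdeg : m.degree = i := by
    by_contra hne
    exact mem_support_iff.1 hm (by rw [coeff_homogeneousComponent, if_neg hne])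
  simp only [Pi.smul_apply, smul_eq_mul, mul_pow, Finset.prod_mul_distrib,
    Finset.prod_pow_eq_pow_sum]
  rw [← hdeg, Finsupp.degree_apply]
  ring

/-- If a polynomial over an infinite field vanishes on a punctured line through the origin, then so
do its homogeneous components. -/
theorem MvPolynomial.eval_homogeneousComponent_eq_zero {k : Type*} [Field k] [Infinite k]
    {τ : Type*} {q : MvPolynomial τ k} {w : τ → k} (h : ∀ c : k, c ≠ 0 → eval (c • w) q = 0)
    (i : ℕ) : eval w (homogeneousComponent i q) = 0 := by
  let Q : Polynomial k := ∑ j ∈ Finset.range (q.totalDegree + 1),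
    Polynomial.monomial j (eval w (homogeneousComponent j q))
  have hQ : Q = 0 := by
    refine Polynomial.eq_zero_of_infinite_isRoot Q ?_
    refine (Set.finite_singleton (0 : k)).infinite_compl.mono fun c hc => ?_
    have := h c hc
    rw [← sum_homogeneousComponent q, map_sum] at this
    simp only [eval_smul_homogeneousComponent] at this
    simpa [Q, Polynomial.IsRoot, Polynomial.eval_finsetSum, mul_comm] using this
  by_cases hi : q.totalDegree < i
  · rw [homogeneousComponent_eq_zero _ _ hi, map_zero]
  · have := congrArg (fun P => Polynomial.coeff P i) hQ
    simpa [Q, Polynomial.finsetSum_coeff, Polynomial.coeff_monomial, Nat.lt_succ_iff,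
      not_lt.1 hi] using this

/-- The polynomials in `w`, with coefficients polynomials in `a`, that vanish at all points `(a, w)`
of `V`. -/
noncomputable def fibrewiseVanishingIdeal {k : Type*} [Field k] {σ τ : Type*}
    (V : Set ((σ → k) × (τ → k))) : Ideal (MvPolynomial τ (MvPolynomial σ k)) :=
  ⨅ x ∈ V, RingHom.ker
    ((MvPolynomial.eval x.2).comp (MvPolynomial.map (MvPolynomial.eval x.1)))

theorem mem_fibrewiseVanishingIdeal {k : Type*} [Field k] {σ τ : Type*}
    {V : Set ((σ → k) × (τ → k))} {p : MvPolynomial τ (MvPolynomial σ k)} :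
    p ∈ fibrewiseVanishingIdeal V ↔
      ∀ x ∈ V, MvPolynomial.eval x.2 (MvPolynomial.map (MvPolynomial.eval x.1) p) = 0 := by
  simp [fibrewiseVanishingIdeal]

open MvPolynomial in
/-- If the fibre over `a` of a closed set `V`, seen as a family of sets of vectors `w`, contains no
nonzero vector, then the equations of `V` at `a` generate all forms of some degree: this is the
projective Nullstellensatz. -/
theorem exists_monomials_mem_map_fibrewiseVanishingIdeal {k : Type*} [Field k] [IsAlgClosed k]
    {σ τ : Type*} [Finite τ] {V : Set ((σ → k) × (τ → k))}
    (hV : ∀ x ∉ V, ∃ p ∈ fibrewiseVanishingIdeal V, eval x.2 (map (eval x.1) p) ≠ 0)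
    {a : σ → k} (ha : ∀ w, (a, w) ∈ V → w = 0) :
    ∃ D : ℕ, ∀ m : τ →₀ ℕ, m.degree = D → ∃ p ∈ fibrewiseVanishingIdeal V,
      map (eval a) p = monomial m (1 : k) := by
  let I : Ideal (MvPolynomial τ k) := (fibrewiseVanishingIdeal V).map (map (eval a))
  have hle : idealOfVars τ k ≤ I.radical := by
    rw [← vanishingIdeal_zeroLocus_eq_radical (K := k), Ideal.span_le]
    rintro _ ⟨j, rfl⟩
    refine mem_vanishingIdeal_iff.2 fun w hw => ?_
    have hw0 : w = 0 := by
      refine ha w ?_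
      by_contra hwV
      obtain ⟨p, hp, hpw⟩ := hV _ hwV
      refine hpw ?_
      simpa [aeval_eq_eval] using mem_zeroLocus_iff.1 hw _ (Ideal.mem_map_of_mem _ hp)
    simp [hw0]
  obtain ⟨D, hD⟩ := Ideal.exists_pow_le_of_le_radical_of_fg hle (idealOfVars_fg τ k)
  refine ⟨D, fun m hm => ?_⟩
  have hsurj : Function.Surjective (map (σ := τ) (eval (R := k) a)) :=
    map_surjective _ fun c => ⟨C c, by simp⟩
  exact (Ideal.mem_map_iff_of_surjective _ hsurj).1
    (hD ((monomial_mem_pow_idealOfVars_iff D m one_ne_zero).2 hm.ge))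

open MvPolynomial in
/-- Main theorem of elimination theory: over an algebraically closed field, the projection to the
`a`-space of the nonzero part of a closed set of pairs `(a, w)` that is a cone in `w` is closed. -/
theorem exists_separating_projection {k : Type*} [Field k] [IsAlgClosed k]
    {σ τ : Type*} [Finite τ] {V : Set ((σ → k) × (τ → k))}
    (hscale : ∀ (c : k) (a : σ → k) (w : τ → k), c ≠ 0 → (a, w) ∈ V → (a, c • w) ∈ V)
    (hV : ∀ x ∉ V, ∃ p ∈ fibrewiseVanishingIdeal V, eval x.2 (map (eval x.1) p) ≠ 0)
    {a : σ → k} (ha : ∀ w, (a, w) ∈ V → w = 0) :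
    ∃ f : MvPolynomial σ k, (∀ b w, (b, w) ∈ V → w ≠ 0 → eval b f = 0) ∧ eval a f ≠ 0 := by
  classical
  have : Infinite k := IsAlgClosed.instInfinite
  have := Fintype.ofFinite τ
  obtain ⟨D, hD⟩ := exists_monomials_mem_map_fibrewiseVanishingIdeal hV ha
  obtain ⟨ι, hι⟩ : ∃ ι : Finset (τ →₀ ℕ), ∀ m, m ∈ ι ↔ m.degree = D :=
    ⟨Finset.finsuppAntidiag Finset.univ D, fun m => by
      rw [Finset.mem_finsuppAntidiag, Finsupp.degree_eq_sum]
      simp⟩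
  choose p hp hpa using fun m : ι => hD m.1 ((hι m.1).1 m.2)
  -- The forms of degree `D` vanishing on `V` that specialise at `a` to the monomials of degree `D`
  -- have a square matrix of coefficients; it specialises at `a` to the identity, while at a point
  -- `b` below a nonzero `w` it kills the vector of the monomials in `w`.
  let M : Matrix ι ι (MvPolynomial σ k) := fun m m' => coeff m'.1 (p m)
  refine ⟨M.det, fun b w hbw hw => ?_, ?_⟩
  · rw [RingHom.map_det]
    refine Matrix.exists_mulVec_eq_zero_iff.1 ⟨fun m => ∏ j, w j ^ m.1 j, fun h0 => hw ?_, ?_⟩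
    · funext j
      have hj : Finsupp.single j D ∈ ι := by simp [hι]
      have := congrFun h0 ⟨_, hj⟩
      simp only [Pi.zero_apply] at this
      rw [Finset.prod_eq_single j (fun i _ hij => by simp [Finsupp.single_eq_of_ne hij])
        (by simp)] at this
      exact eq_zero_of_pow_eq_zero this
    · funext m
      have hline : ∀ c : k, c ≠ 0 → eval (c • w) (map (eval b) (p m)) = 0 := fun c hc =>
        mem_fibrewiseVanishingIdeal.1 (hp m) (b, c • w) (hscale c b w hc hbw)
      have h0 : eval w (homogeneousComponent D (map (eval b) (p m))) = 0 :=
        eval_homogeneousComponent_eq_zero hline D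
      rw [eval_eq'] at h0
      have hsub : (homogeneousComponent D (map (eval b) (p m))).support ⊆ ι := fun m' hm' =>
        (hι m').2 (by
          by_contra hne
          exact mem_support_iff.1 hm' (by rw [coeff_homogeneousComponent, if_neg hne]))
      rw [Finset.sum_subset hsub (fun m' _ hm' => by rw [notMem_support_iff.1 hm', zero_mul]),
        ← Finset.sum_coe_sort] at h0
      rw [Pi.zero_apply, ← h0]
      refine Finset.sum_congr rfl fun m' _ => ?_
      rw [coeff_homogeneousComponent, if_pos ((hι _).1 m'.2), coeff_map]
      rfl
  · have h1 : (eval a).mapMatrix M = 1 := by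
      ext m m'
      have := congrArg (coeff m'.1) (hpa m)
      rw [coeff_map, coeff_monomial] at this
      simp only [Matrix.one_apply, Subtype.ext_iff]
      exact this
    rw [RingHom.map_det, h1, Matrix.det_one]
    exact one_ne_zero

open MvPolynomial in
/-- The linear case of elimination, valid over any field: the parameters for which a system of
homogeneous linear equations has a nonzero solution form a closed set. -/
theorem exists_separating_linear_system {k : Type*} [Field k] {σ ι τ : Type*} [Finite ι]
    [Fintype τ] (T : Matrix ι τ (MvPolynomial σ k)) {a : σ → k}
    (ha : ∀ w, (T.map (eval a)).mulVec w = 0 → w = 0) :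
    ∃ f : MvPolynomial σ k,
      (∀ b w, (T.map (eval b)).mulVec w = 0 → w ≠ 0 → eval b f = 0) ∧ eval a f ≠ 0 := by
  classical
  have := Fintype.ofFinite ι
  obtain ⟨g, hg⟩ := LinearMap.exists_leftInverse_of_injective (T.map (eval a)).mulVecLin
    (LinearMap.ker_eq_bot'.2 ha)
  -- A constant left inverse `L` of the system at `a` turns the system into a square one.
  let L : Matrix τ ι k := LinearMap.toMatrix' g
  let L' : Matrix τ ι (MvPolynomial σ k) := L.map C
  have hL : L * T.map (eval a) = 1 := by
    have := congrArg LinearMap.toMatrix' hg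
    rwa [LinearMap.toMatrix'_comp, LinearMap.toMatrix'_id, ← Matrix.toLin'_apply',
      LinearMap.toMatrix'_toLin'] at this
  have hmap : ∀ b : σ → k, (eval b).mapMatrix (L' * T) = L * T.map (eval b) := fun b => by
    rw [RingHom.mapMatrix_apply, Matrix.map_mul]
    congr 1
    ext i j
    simp [L']
  refine ⟨(L' * T).det, fun b w hbw hw => ?_, ?_⟩
  · rw [RingHom.map_det, hmap]
    exact Matrix.exists_mulVec_eq_zero_iff.1 ⟨w, hw, by rw [← Matrix.mulVec_mulVec, hbw,
      Matrix.mulVec_zero]⟩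
  · rw [RingHom.map_det, hmap, hL, Matrix.det_one]
    exact one_ne_zero

/-! ### Chains of commuting matrices -/

/-- `CommutingChain d A B` says that `A` and `B` are joined by a chain of consecutively commuting
matrices with `d` non-scalar intermediate terms. Repetitions in the chain are allowed, and `A`, `B`
may be scalar. -/
def CommutingChain {k : Type*} [Field k] {n : ℕ} :
    ℕ → Matrix (Fin n) (Fin n) k → Matrix (Fin n) (Fin n) k → Prop
  | 0, A, B => Commute A B
  | d + 1, A, B => ∃ C, ¬ IsScalarMatrix C ∧ Commute A C ∧ CommutingChain d C B

theorem IsScalarMatrix.commute {k : Type*} [Field k] {n : ℕ} {A : Matrix (Fin n) (Fin n) k}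
    (hA : IsScalarMatrix A) (B : Matrix (Fin n) (Fin n) k) : Commute A B := by
  obtain ⟨c, rfl⟩ := hA
  exact (Commute.one_left B).smul_left c

theorem exists_not_isScalarMatrix {k : Type*} [Field k] {n : ℕ} (hn : 2 ≤ n) :
    ∃ A : Matrix (Fin n) (Fin n) k, ¬ IsScalarMatrix A := by
  have hne : (⟨0, by omega⟩ : Fin n) ≠ ⟨1, by omega⟩ := by simp
  refine ⟨Matrix.single ⟨0, by omega⟩ ⟨1, by omega⟩ 1, ?_⟩
  rintro ⟨c, hc⟩
  have := congrFun (congrFun hc ⟨0, by omega⟩) ⟨1, by omega⟩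
  simp [Matrix.one_apply_ne hne] at this

namespace CommutingChain

variable {k : Type*} [Field k] {n : ℕ} {A B : Matrix (Fin n) (Fin n) k} {d : ℕ}

theorem smul (h : CommutingChain d A B) (c : k) : CommutingChain d (c • A) B := by
  cases d with
  | zero => exact Commute.smul_left (show Commute A B from h) c
  | succ d =>
    obtain ⟨C, hC, hAC, hCB⟩ := h
    exact ⟨C, hC, hAC.smul_left c, hCB⟩

theorem sub_smul_one (h : CommutingChain d A B) (c : k) : CommutingChain d (A - c • 1) B := by
  have hc : ∀ C, Commute (c • (1 : Matrix (Fin n) (Fin n) k)) C :=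
    IsScalarMatrix.commute ⟨c, rfl⟩
  cases d with
  | zero => exact Commute.sub_left (show Commute A B from h) (hc B)
  | succ d =>
    obtain ⟨C, hC, hAC, hCB⟩ := h
    exact ⟨C, hC, hAC.sub_left (hc C), hCB⟩

theorem refl (hA : ¬ IsScalarMatrix A) (d : ℕ) : CommutingChain d A A := by
  induction d with
  | zero => exact Commute.refl A
  | succ d ih => exact ⟨A, hA, Commute.refl A, ih⟩

theorem of_isScalarMatrix_right (hn : 2 ≤ n) (hB : IsScalarMatrix B)
    (A : Matrix (Fin n) (Fin n) k) (d : ℕ) : CommutingChain d A B := by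
  induction d generalizing A with
  | zero => exact (hB.commute A).symm
  | succ d ih =>
    by_cases hA : IsScalarMatrix A
    · obtain ⟨C, hC⟩ := exists_not_isScalarMatrix (k := k) hn
      exact ⟨C, hC, hA.commute C, ih C⟩
    · exact ⟨A, hA, Commute.refl A, ih A⟩

theorem of_isScalarMatrix_left (hn : 2 ≤ n) (hA : IsScalarMatrix A)
    (B : Matrix (Fin n) (Fin n) k) (d : ℕ) : CommutingChain d A B := by
  by_cases hB : IsScalarMatrix B
  · exact of_isScalarMatrix_right hn hB A d
  · cases d with
    | zero => exact hA.commute B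
    | succ d => exact ⟨B, hB, hA.commute B, refl hB d⟩

theorem iff_edist_le (hA : ¬ IsScalarMatrix A) (hB : ¬ IsScalarMatrix B) (d : ℕ) :
    CommutingChain d A B ↔ (commutingGraph k n).edist ⟨A, hA⟩ ⟨B, hB⟩ ≤ (d + 1 : ℕ) := by
  have hone : ∀ {C D : Matrix (Fin n) (Fin n) k} (hC : ¬ IsScalarMatrix C)
      (hD : ¬ IsScalarMatrix D), (commutingGraph k n).edist ⟨C, hC⟩ ⟨D, hD⟩ ≤ 1 ↔
        Commute C D := by
    intro C D hC hD
    rw [SimpleGraph.edist_le_one_iff_adj_or_eq, Subtype.mk.injEq]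
    constructor
    · rintro (h | rfl)
      · exact h.2
      · exact Commute.refl C
    · intro h
      by_cases hCD : C = D
      · exact Or.inr hCD
      · exact Or.inl ⟨fun h' => hCD (congrArg Subtype.val h'), h⟩
  induction d generalizing A with
  | zero => simpa [CommutingChain] using (hone hA hB).symm
  | succ d ih =>
    constructor
    · rintro ⟨C, hC, hAC, hCB⟩
      calc _ ≤ (commutingGraph k n).edist ⟨A, hA⟩ ⟨C, hC⟩ +
            (commutingGraph k n).edist ⟨C, hC⟩ ⟨B, hB⟩ := SimpleGraph.edist_triangle
        _ ≤ 1 + (d + 1 : ℕ) := add_le_add ((hone hA hC).2 hAC) ((ih hC).1 hCB)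
        _ = (d + 1 + 1 : ℕ) := by push_cast; ring
    · intro h
      obtain ⟨p, hp⟩ := SimpleGraph.exists_walk_of_edist_ne_top
        (ne_top_of_le_ne_top (ENat.natCast_ne_top _) h)
      rw [← hp, Nat.cast_le] at h
      cases p with
      | nil => exact refl hA _
      | @cons _ C _ hAC q =>
        refine ⟨C.1, C.2, hAC.2, (ih C.2).2 ((SimpleGraph.edist_le q).trans ?_)⟩
        rw [SimpleGraph.Walk.length_cons] at h
        exact_mod_cast Nat.le_of_succ_le_succ h

/-- The intermediate matrices only matter modulo scalar matrices, so they may be normalised to have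
a prescribed diagonal entry zero; being non-scalar then means being nonzero. -/
theorem succ_iff (i₀ : Fin n) : CommutingChain (d + 1) A B ↔
    ∃ C, C ≠ 0 ∧ C i₀ i₀ = 0 ∧ Commute A C ∧ CommutingChain d C B := by
  constructor
  · rintro ⟨C, hC, hAC, hCB⟩
    refine ⟨C - C i₀ i₀ • 1, fun h => hC ⟨_, sub_eq_zero.1 h⟩, by simp, ?_, hCB.sub_smul_one _⟩
    exact hAC.sub_right (IsScalarMatrix.commute ⟨_, rfl⟩ A).symm
  · rintro ⟨C, hC0, hC, hAC, hCB⟩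
    refine ⟨C, ?_, hAC, hCB⟩
    rintro ⟨c, rfl⟩
    simp_all

end CommutingChain

theorem mem_commutingSet_succ {k : Type*} [Field k] {n : ℕ} (hn : 2 ≤ n) (d : ℕ)
    (p : Matrix (Fin n) (Fin n) k × Matrix (Fin n) (Fin n) k) :
    p ∈ commutingSet k n (d + 1) ↔ CommutingChain d p.1 p.2 := by
  rw [commutingSet, Set.mem_ofPred_eq, commutingDist]
  split_ifs with h h'
  · exact (CommutingChain.iff_edist_le h.1 h.2 d).symm
  all_goals
    have : CommutingChain d p.1 p.2 := by
      by_cases hA : IsScalarMatrix p.1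
      · exact .of_isScalarMatrix_left hn hA _ d
      · exact .of_isScalarMatrix_right hn (by tauto) _ d
    simp [this]

theorem mem_commutingSet_zero {k : Type*} [Field k] {n : ℕ}
    (p : Matrix (Fin n) (Fin n) k × Matrix (Fin n) (Fin n) k) :
    p ∈ commutingSet k n 0 ↔ p.1 = p.2 := by
  rw [commutingSet, Set.mem_ofPred_eq, commutingDist]
  split_ifs with h h'
  · simp
  · simp [h']
  · simp [h']

/-! ### Equations for commuting matrices -/

/-- The matrix, in the coordinates given by the entries, of the linear map `W ↦ A * W - W * A`. -/
def commutatorMatrix {R : Type*} [CommRing R] {n : ℕ} (A : Matrix (Fin n) (Fin n) R) :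
    Matrix (Fin n × Fin n) (Fin n × Fin n) R :=
  Matrix.of fun ij lm =>
    A ij.1 lm.1 * (1 : Matrix (Fin n) (Fin n) R) lm.2 ij.2 -
      (1 : Matrix (Fin n) (Fin n) R) ij.1 lm.1 * A lm.2 ij.2

theorem commutatorMatrix_map {R S : Type*} [CommRing R] [CommRing S] {n : ℕ} (φ : R →+* S)
    (A : Matrix (Fin n) (Fin n) R) :
    (commutatorMatrix A).map φ = commutatorMatrix (A.map φ) := by
  ext ij lm
  simp [commutatorMatrix, Matrix.one_apply, apply_ite φ]

/-- The square matrix with a given family of entries. -/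
def matrixOfEntries {R : Type*} {n : ℕ} (w : Fin n × Fin n → R) : Matrix (Fin n) (Fin n) R :=
  Matrix.of fun i j => w (i, j)

theorem commutatorMatrix_mulVec {R : Type*} [CommRing R] {n : ℕ} (A : Matrix (Fin n) (Fin n) R)
    (w : Fin n × Fin n → R) (i j : Fin n) :
    (commutatorMatrix A).mulVec w (i, j) =
      (A * matrixOfEntries w - matrixOfEntries w * A) i j := by
  simp [commutatorMatrix, matrixOfEntries, Matrix.mulVec, dotProduct, Fintype.sum_prod_type,
    sub_mul, Finset.sum_sub_distrib, Matrix.one_apply, Matrix.mul_apply]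
  simp [mul_comm]

theorem commutatorMatrix_mulVec_eq_zero_iff {R : Type*} [CommRing R] {n : ℕ}
    {A : Matrix (Fin n) (Fin n) R} {w : Fin n × Fin n → R} :
    (commutatorMatrix A).mulVec w = 0 ↔ Commute A (matrixOfEntries w) := by
  rw [commute_iff_eq, ← sub_eq_zero (a := A * matrixOfEntries w), funext_iff, ← Matrix.ext_iff,
    Prod.forall]
  simp only [commutatorMatrix_mulVec, Pi.zero_apply, Matrix.zero_apply]

/-! ### Closedness of the commuting sets -/

/-- The pairs of matrices joined by a chain with `d` non-scalar intermediate terms, in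
coordinates. -/
def commutingChainSet (k : Type*) [Field k] (n d : ℕ) :
    Set ((Fin n × Fin n) ⊕ (Fin n × Fin n) → k) :=
  {a | CommutingChain d (matrixOfEntries (a ∘ Sum.inl)) (matrixOfEntries (a ∘ Sum.inr))}

theorem image_commutingSet_succ (k : Type*) [Field k] {n : ℕ} (hn : 2 ≤ n) (d : ℕ) :
    matrixPairEquiv k n '' commutingSet k n (d + 1) = commutingChainSet k n d := by
  ext a
  rw [Equiv.image_eq_preimage_symm, Set.mem_preimage, mem_commutingSet_succ hn]
  rfl

theorem isAffineVariety_image_commutingSet_zero (k : Type*) [Field k] (n : ℕ) :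
    IsAffineVariety (matrixPairEquiv k n '' commutingSet k n 0) := by
  refine isAffineVariety_of_separated fun a ha => ?_
  rw [Equiv.image_eq_preimage_symm]
  have hmem : ∀ b, b ∈ (matrixPairEquiv k n).symm ⁻¹' commutingSet k n 0 ↔
      ∀ ij, b (Sum.inl ij) = b (Sum.inr ij) := fun b => by
    rw [Set.mem_preimage, mem_commutingSet_zero, ← Matrix.ext_iff, Prod.forall]
    rfl
  rw [Equiv.image_eq_preimage_symm, hmem, not_forall] at ha
  obtain ⟨ij, hij⟩ := ha
  refine ⟨MvPolynomial.X (Sum.inl ij) - MvPolynomial.X (Sum.inr ij), fun b hb => ?_, ?_⟩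
  · simp [(hmem b).1 hb ij]
  · simpa [sub_eq_zero] using hij

open MvPolynomial in
theorem exists_separating_commutingChainSet_zero {k : Type*} [Field k] {n : ℕ}
    {a : (Fin n × Fin n) ⊕ (Fin n × Fin n) → k} (ha : a ∉ commutingChainSet k n 0) :
    ∃ f : MvPolynomial _ k, (∀ b ∈ commutingChainSet k n 0, eval b f = 0) ∧ eval a f ≠ 0 := by
  let N := (commutatorMatrix (matrixOfEntries (fun ij => X (R := k) (Sum.inl ij)))).mulVec
    (fun ij => X (R := k) (Sum.inr ij : (Fin n × Fin n) ⊕ (Fin n × Fin n)))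
  have hN : ∀ b ij, eval b (N ij) =
      (commutatorMatrix (matrixOfEntries (b ∘ Sum.inl))).mulVec (b ∘ Sum.inr) ij := by
    intro b ij
    rw [RingHom.map_mulVec, commutatorMatrix_map]
    congr
    · ext; simp [matrixOfEntries]
    · ext; simp
  have hmem : ∀ b, b ∈ commutingChainSet k n 0 ↔ ∀ ij, eval b (N ij) = 0 := fun b => by
    simp only [hN]
    exact commutatorMatrix_mulVec_eq_zero_iff.symm.trans funext_iff
  rw [hmem, not_forall] at ha
  obtain ⟨ij, hij⟩ := ha
  exact ⟨N ij, fun b hb => (hmem b).1 hb ij, hij⟩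

/-- The pairs consisting of `a = (A, B)` and `C` such that `C` is normalised to have a zero entry
at `(i₀, i₀)`, commutes with `A`, and is joined to `B` by a chain with `d` intermediate terms. -/
def firstStepSet (k : Type*) [Field k] {n : ℕ} (i₀ : Fin n) (d : ℕ) :
    Set (((Fin n × Fin n) ⊕ (Fin n × Fin n) → k) × (Fin n × Fin n → k)) :=
  {x | x.2 (i₀, i₀) = 0 ∧ Commute (matrixOfEntries (x.1 ∘ Sum.inl)) (matrixOfEntries x.2) ∧
    Sum.elim x.2 (x.1 ∘ Sum.inr) ∈ commutingChainSet k n d}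

theorem mem_commutingChainSet_succ_iff {k : Type*} [Field k] {n : ℕ} (i₀ : Fin n) {d : ℕ}
    {a : (Fin n × Fin n) ⊕ (Fin n × Fin n) → k} :
    a ∈ commutingChainSet k n (d + 1) ↔ ∃ w, w ≠ 0 ∧ (a, w) ∈ firstStepSet k i₀ d := by
  refine (CommutingChain.succ_iff i₀).trans ⟨?_, ?_⟩
  · rintro ⟨C, hC0, hC⟩
    exact ⟨fun ij => C ij.1 ij.2, fun h => hC0 (Matrix.ext fun i j => congrFun h (i, j)), hC⟩
  · rintro ⟨w, hw0, hw⟩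
    exact ⟨matrixOfEntries w,
      fun h => hw0 (funext fun ij => congrFun (congrFun h ij.1) ij.2), hw⟩

open MvPolynomial in
/-- One intermediate matrix: its entries solve a system of homogeneous linear equations, so that no
assumption on the field is needed. -/
theorem exists_separating_commutingChainSet_one {k : Type*} [Field k] {n : ℕ} (i₀ : Fin n)
    {a : (Fin n × Fin n) ⊕ (Fin n × Fin n) → k} (ha : a ∉ commutingChainSet k n 1) :
    ∃ f : MvPolynomial _ k, (∀ b ∈ commutingChainSet k n 1, eval b f = 0) ∧ eval a f ≠ 0 := by
  let T : Matrix ((Fin n × Fin n) ⊕ (Fin n × Fin n) ⊕ Unit) (Fin n × Fin n)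
      (MvPolynomial ((Fin n × Fin n) ⊕ (Fin n × Fin n)) k) :=
    Sum.elim (commutatorMatrix (matrixOfEntries (fun ij => X (Sum.inl ij))))
      (Sum.elim (commutatorMatrix (matrixOfEntries (fun ij => X (Sum.inr ij))))
        (fun _ => Pi.single (i₀, i₀) 1))
  have hT : ∀ b w, (T.map (eval b)).mulVec w = 0 ↔ (b, w) ∈ firstStepSet k i₀ 0 := by
    intro b w
    have hmap : T.map (eval b) = Sum.elim (commutatorMatrix (matrixOfEntries (b ∘ Sum.inl)))
        (Sum.elim (commutatorMatrix (matrixOfEntries (b ∘ Sum.inr)))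
          (fun _ => Pi.single (i₀, i₀) 1)) := by
      have h : ∀ g : Fin n × Fin n → (Fin n × Fin n) ⊕ (Fin n × Fin n),
          (commutatorMatrix (matrixOfEntries fun ij => X (R := k) (g ij))).map (eval b) =
            commutatorMatrix (matrixOfEntries (b ∘ g)) := fun g => by
        rw [commutatorMatrix_map]
        congr
        ext
        simp [matrixOfEntries]
      funext i lm
      rcases i with ij | ij | u
      · exact congrFun (congrFun (h Sum.inl) ij) lm
      · exact congrFun (congrFun (h Sum.inr) ij) lm
      · change eval b ((Pi.single (i₀, i₀) 1 : Fin n × Fin n → MvPolynomial _ k) lm) =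
          (Pi.single (i₀, i₀) 1 : Fin n × Fin n → k) lm
        simp [Pi.single_apply, apply_ite (eval b)]
    have hcoord : (Pi.single (i₀, i₀) 1 : Fin n × Fin n → k) ⬝ᵥ w = w (i₀, i₀) := by simp
    have hcomm : ∀ v : Fin n × Fin n → k,
        (∀ ij, (commutatorMatrix (matrixOfEntries v)).mulVec w ij = 0) ↔
          Commute (matrixOfEntries v) (matrixOfEntries w) := fun v =>
      _root_.funext_iff.symm.trans commutatorMatrix_mulVec_eq_zero_iff
    rw [hmap, _root_.funext_iff, Sum.forall, Sum.forall]
    change (∀ ij, (commutatorMatrix (matrixOfEntries (b ∘ Sum.inl))).mulVec w ij = 0) ∧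
      (∀ ij, (commutatorMatrix (matrixOfEntries (b ∘ Sum.inr))).mulVec w ij = 0) ∧
      (∀ _ : Unit, (Pi.single (i₀, i₀) 1 : Fin n × Fin n → k) ⬝ᵥ w = 0) ↔
      w (i₀, i₀) = 0 ∧ Commute (matrixOfEntries (b ∘ Sum.inl)) (matrixOfEntries w) ∧
        Commute (matrixOfEntries w) (matrixOfEntries (b ∘ Sum.inr))
    rw [hcomm, hcomm, hcoord, Commute.symm_iff (a := matrixOfEntries w)]
    tauto
  simp only [mem_commutingChainSet_succ_iff i₀ (d := 0), ← hT] at ha ⊢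
  obtain ⟨f, hf, hfa⟩ := exists_separating_linear_system T (a := a) fun w hw => by
    by_contra hw0
    exact ha ⟨w, hw0, hw⟩
  exact ⟨f, fun b ⟨w, hw0, hw⟩ => hf b w hw hw0, hfa⟩

open MvPolynomial in
theorem exists_separating_firstStepSet {k : Type*} [Field k] {n : ℕ} (i₀ : Fin n) {d : ℕ}
    (hd : ∀ a ∉ commutingChainSet k n d, ∃ f : MvPolynomial _ k,
      (∀ b ∈ commutingChainSet k n d, eval b f = 0) ∧ eval a f ≠ 0)
    {x : ((Fin n × Fin n) ⊕ (Fin n × Fin n) → k) × (Fin n × Fin n → k)}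
    (hx : x ∉ firstStepSet k i₀ d) :
    ∃ p ∈ fibrewiseVanishingIdeal (firstStepSet k i₀ d), eval x.2 (map (eval x.1) p) ≠ 0 := by
  simp only [mem_fibrewiseVanishingIdeal]
  -- Both conditions on `C` that involve a second matrix are pulled back along a substitution of
  -- coordinates of `(A, B)` and of `C`.
  let Φ : (((Fin n × Fin n) ⊕ (Fin n × Fin n)) →
        MvPolynomial (Fin n × Fin n) (MvPolynomial ((Fin n × Fin n) ⊕ (Fin n × Fin n)) k)) →
      MvPolynomial ((Fin n × Fin n) ⊕ (Fin n × Fin n)) k →+* _ := eval₂Hom (C.comp C)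
  have hΦ : ∀ v f (y : ((Fin n × Fin n) ⊕ (Fin n × Fin n) → k) × (Fin n × Fin n → k)),
      eval y.2 (map (eval y.1) (Φ v f)) =
        eval (fun i => eval y.2 (map (eval y.1) (v i))) f := fun v f y => by
    change (((eval y.2).comp (map (eval y.1))).comp (Φ v)) f = _
    congr 1
    ext <;> simp [Φ]
  have hAC : ∀ y : ((Fin n × Fin n) ⊕ (Fin n × Fin n) → k) × (Fin n × Fin n → k),
      (fun i => eval y.2 (map (eval y.1)
        (Sum.elim (fun ij => C (X (Sum.inl ij))) X i))) = Sum.elim (y.1 ∘ Sum.inl) y.2 :=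
      fun y => by
    ext (ij | ij) <;> simp
  have hCB : ∀ y : ((Fin n × Fin n) ⊕ (Fin n × Fin n) → k) × (Fin n × Fin n → k),
      (fun i => eval y.2 (map (eval y.1)
        (Sum.elim X (fun ij => C (X (Sum.inr ij))) i))) = Sum.elim y.2 (y.1 ∘ Sum.inr) :=
      fun y => by
    ext (ij | ij) <;> simp
  by_cases h1 : x.2 (i₀, i₀) = 0
  · by_cases h2 : Sum.elim (x.1 ∘ Sum.inl) x.2 ∈ commutingChainSet k n 0
    · obtain ⟨f, hf, hfx⟩ := hd (Sum.elim x.2 (x.1 ∘ Sum.inr)) fun h3 => hx ⟨h1, h2, h3⟩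
      refine ⟨Φ (Sum.elim X (fun ij => C (X (Sum.inr ij)))) f, fun y hy => ?_, ?_⟩
      · rw [hΦ, hCB]
        exact hf _ hy.2.2
      · rwa [hΦ, hCB]
    · obtain ⟨f, hf, hfx⟩ := exists_separating_commutingChainSet_zero h2
      refine ⟨Φ (Sum.elim (fun ij => C (X (Sum.inl ij))) X) f, fun y hy => ?_, ?_⟩
      · rw [hΦ, hAC]
        exact hf _ hy.2.1
      · rwa [hΦ, hAC]
  · exact ⟨X (i₀, i₀), fun y hy => by simpa using hy.1, by simpa using h1⟩

open MvPolynomial in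
/-- Over an algebraically closed field, the intermediate matrices are eliminated one at a time, from
the end of the chain to its start. -/
theorem exists_separating_commutingChainSet {k : Type*} [Field k] [IsAlgClosed k] {n : ℕ}
    (i₀ : Fin n) (d : ℕ) {a : (Fin n × Fin n) ⊕ (Fin n × Fin n) → k}
    (ha : a ∉ commutingChainSet k n d) :
    ∃ f : MvPolynomial _ k, (∀ b ∈ commutingChainSet k n d, eval b f = 0) ∧ eval a f ≠ 0 := by
  induction d generalizing a with
  | zero => exact exists_separating_commutingChainSet_zero ha
  | succ d ih =>
    simp only [mem_commutingChainSet_succ_iff i₀] at ha ⊢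
    have hscale : ∀ (c : k) (b : (Fin n × Fin n) ⊕ (Fin n × Fin n) → k) (w : Fin n × Fin n → k),
        c ≠ 0 → (b, w) ∈ firstStepSet k i₀ d → (b, c • w) ∈ firstStepSet k i₀ d := by
      rintro c b w - ⟨h1, h2, h3⟩
      refine ⟨?_, h2.smul_right c, CommutingChain.smul h3 c⟩
      change c * w (i₀, i₀) = 0
      rw [show w (i₀, i₀) = 0 from h1, mul_zero]
    obtain ⟨f, hf, hfa⟩ := exists_separating_projection hscale
      (fun x hx => exists_separating_firstStepSet i₀ (fun _ => ih) hx) (a := a) fun w hw => by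
        by_contra hw0
        exact ha ⟨w, hw0, hw⟩
    exact ⟨f, fun b ⟨w, hw0, hw⟩ => hf b w hw hw0, hfa⟩

theorem theorem1 (k : Type*) [Field k] (n : ℕ) (hn : 2 ≤ n) :
    (IsAlgClosed k → ∀ d : ℕ, IsAffineVariety (matrixPairEquiv k n '' commutingSet k n d)) ∧
      (∀ d : ℕ, d ≤ 2 → IsAffineVariety (matrixPairEquiv k n '' commutingSet k n d)) := by
  have i₀ : Fin n := ⟨0, by omega⟩
  refine ⟨fun _ d => ?_, fun d hd => ?_⟩
  · cases d with
    | zero => exact isAffineVariety_image_commutingSet_zero k n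
    | succ d =>
      rw [image_commutingSet_succ k hn]
      exact isAffineVariety_of_separated fun a => exists_separating_commutingChainSet i₀ d
  · interval_cases d
    · exact isAffineVariety_image_commutingSet_zero k n
    · rw [image_commutingSet_succ k hn]
      exact isAffineVariety_of_separated fun a => exists_separating_commutingChainSet_zero
    · rw [image_commutingSet_succ k hn]
      exact isAffineVariety_of_separated fun a => exists_separating_commutingChainSet_one i₀
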